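/- For $n\ge 1$ the augmented cube $AQ_n$ is the graph on the set $\{0,1\}^n$ of binary strings of length $n$ defined recursively as follows: $AQ_1$ is the complete graph on $\{0,1\}$; for $n\ge 2$, $AQ_n$ consists of two copies of $AQ_{n-1}$, one on the strings $0x_1\dots x_{n-1}$ and one on the strings $1y_1\dots y_{n-1}$, together with the edges joining $0x_1\dots x_{n-1}$ to $1y_1\dots y_{n-1}$ whenever either $x_i=y_i$ for all $1\le i\le n-1$, or $x_i=1-y_i$ for all $1\le i\le n-1$. A graph is $k$-connected if it has more than $k$ vertices and remains connected after the deletion of any fewer than $k$ vertices. A graph $G$ is $4$-pancyclic if it contains a cycle of every length from $4$ to $|V(G)|$. **Theorem.** Let $n\ge 4$ and $2n-1=n_1+n_2$ with integers $n_1,n_2\ge 2$. Then there are two spanning subgraphs $H_1,H_2$ of $AQ_n$ such that every edge of $AQ_n$ belongs to exactly one of $H_1,H_2$ and, for $i=1,2$, the graph $H_i$ is $n_i$-regular and $n_i$-connected. Moreover, $H_1$ and $H_2$ can be chosen so that, in addition, for each $i\in\{1,2\}$ with $n_i\ge 3$ the graph $H_i$ is $4$-pancyclic. -/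

import Mathlib

namespace AugCube

/-- The augmented cube `AQ n` on the binary strings of length `n`.  `AQ (n + 1)` consists of two
copies of `AQ n` and edges between them: the first symbol `x 0` of a vertex `x` of `AQ (n + 1)` says
in which copy `x` lies, and `Fin.tail x` is the
remaining string.  Two vertices in the same copy are adjacent when their remaining strings are
adjacent in `AQ n`; two vertices in different copies are adjacent when their remaining strings are
equal (hypercube edge) or complementary in every position (complementary edge).
The recursion starts from the one-vertex graph, so `AQ 1` is `K₂` (see `augmentedCube_one`). -/
def augmentedCube : (n : ℕ) → SimpleGraph (Fin n → Bool)
  | 0 => ⊥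
  | n + 1 =>
    { Adj := fun x y =>
        (x 0 = y 0 ∧ (augmentedCube n).Adj (Fin.tail x) (Fin.tail y)) ∨
        (x 0 ≠ y 0 ∧
          (Fin.tail x = Fin.tail y ∨ ∀ i : Fin n, Fin.tail x i = !(Fin.tail y i)))
      symm := ⟨by
        rintro x y (⟨h, h'⟩ | ⟨h, h' | h'⟩)
        · exact Or.inl ⟨h.symm, h'.symm⟩
        · exact Or.inr ⟨h.symm, Or.inl h'.symm⟩
        · exact Or.inr ⟨h.symm, Or.inr fun i => by rw [h' i, Bool.not_not]⟩⟩
      loopless := ⟨by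
        rintro x (⟨_, h⟩ | ⟨h, _⟩)
        · exact (augmentedCube n).loopless.irrefl _ h
        · exact h rfl⟩ }

theorem augmentedCube_one : augmentedCube 1 = ⊤ := by
  ext x y
  simp [augmentedCube, funext_iff, Fin.forall_fin_one]

variable {V : Type*}

/-- `H₁, H₂` is a decomposition of `G` into two spanning subgraphs (both have the whole vertex set
of `G`): every edge of `G` is an edge of exactly one of them, and they have no other edges. -/
def IsDecomposition (G H₁ H₂ : SimpleGraph V) : Prop :=
  H₁.edgeSet ∪ H₂.edgeSet = G.edgeSet ∧ Disjoint H₁.edgeSet H₂.edgeSet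

open scoped Classical in
/-- Every vertex of `G` has degree `k`. -/
def IsRegular [Fintype V] (G : SimpleGraph V) (k : ℕ) : Prop :=
  G.IsRegularOfDegree k

/-- `G` is `k`-connected: it has more than `k` vertices, and it stays connected whenever fewer than
`k` vertices are deleted. -/
def IsKConnected [Fintype V] (G : SimpleGraph V) (k : ℕ) : Prop :=
  k < Fintype.card V ∧
    ∀ S : Finset V, S.card < k → (G.induce ((S : Set V)ᶜ)).Connected

/-- `G` is `r`-pancyclic: it contains a cycle of every length from `r` to the number of its
vertices. -/
def IsPancyclicFrom [Fintype V] (G : SimpleGraph V) (r : ℕ) : Prop :=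
  ∀ l : ℕ, r ≤ l → l ≤ Fintype.card V →
    ∃ (v : V) (c : G.Walk v v), c.IsCycle ∧ c.length = l

end AugCube

/-! Consecutive numbers, in binary and cyclically, agree up to a suffix on which they are
complementary. So counting gives a Hamiltonian cycle of the augmented cube (`countingCycle_le`).
What remains, `cocycle n`, is (2n-3)-regular, and for n ≥ 3 it is (2n-3)-connected and 4-pancyclic
(`cocycle_isKConnected`, `cocycle_pancyclic`). With n₁ ≤ n₂ by symmetry, this settles n₁ = 2.

From AQ_n to AQ_{n+1} two perfect matchings are added, x ↔ x and x ↔ xᶜ. Doubling both factors and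
giving one matching to each raises both degrees and both connectivities by 1
(`exists_good_decomposition_succ`), so the rest reduces to n₁ = 3. There the doubled factor is an
even cycle, and either pure matching would make it bipartite. The two matchings are therefore
exchanged at the all-zero and all-one strings (`swapEnds`), which creates odd cycles.

Cycle lengths are carried along by a `Rung`: its odd paths yield the even cycles, and its path
missing one vertex, of even length, yields the odd cycles too long to fit in one copy. -/

namespace AugCube

/-! ### Paths as lists, and cycles obtained by closing them -/

section Path

variable {V W : Type*}

/-- There is a path of length `k` from `a` to `b` in `G`. -/
def HasPath (G : SimpleGraph V) (a b : V) (k : ℕ) : Prop :=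
  ∃ l : List V, l.IsChain G.Adj ∧ l.Nodup ∧ l.head? = some a ∧ l.getLast? = some b ∧
    l.length = k + 1

theorem HasPath.symm {G : SimpleGraph V} {a b : V} {k : ℕ} (h : HasPath G a b k) :
    HasPath G b a k := by
  obtain ⟨l, h1, h2, h3, h4, h5⟩ := h
  refine ⟨l.reverse, ?_, List.nodup_reverse.2 h2, by simpa using h4, by simpa using h3, by simpa⟩
  rw [List.isChain_reverse]
  exact h1.imp fun _ _ h => h.symm

theorem HasPath.map {G : SimpleGraph V} {G' : SimpleGraph W} {f : V → W}
    (hf : Function.Injective f) (hG : ∀ x y, G.Adj x y → G'.Adj (f x) (f y))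
    {a b : V} {k : ℕ} (h : HasPath G a b k) : HasPath G' (f a) (f b) k := by
  obtain ⟨l, h1, h2, h3, h4, h5⟩ := h
  refine ⟨l.map f, ?_, h2.map hf, by simp [h3], by simp [h4], by simpa⟩
  rw [List.isChain_map]
  exact h1.imp fun x y h => hG x y h

theorem hasPath_one {G : SimpleGraph V} {a b : V} (h : G.Adj a b) : HasPath G a b 1 :=
  ⟨[a, b], by simpa, by simpa using h.ne, by simp, by simp, by simp⟩

/-- Two paths in different copies, joined by an edge. -/
theorem HasPath.append {G₀ G₁ : SimpleGraph V} {G : SimpleGraph W} {f g : V → W}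
    (hf : Function.Injective f) (hg : Function.Injective g) (hfg : ∀ x y, f x ≠ g y)
    (hG₀ : ∀ x y, G₀.Adj x y → G.Adj (f x) (f y)) (hG₁ : ∀ x y, G₁.Adj x y → G.Adj (g x) (g y))
    {a b c d : V} {i j : ℕ} (h₀ : HasPath G₀ a b i) (h₁ : HasPath G₁ c d j)
    (h : G.Adj (f b) (g c)) : HasPath G (f a) (g d) (i + j + 1) := by
  obtain ⟨l, h1, h2, h3, h4, h5⟩ := h₀
  obtain ⟨m, k1, k2, k3, k4, k5⟩ := h₁
  refine ⟨l.map f ++ m.map g, ?_, ?_, ?_, ?_, ?_⟩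
  · rw [List.isChain_append, List.isChain_map, List.isChain_map]
    refine ⟨h1.imp fun x y h => hG₀ x y h, k1.imp fun x y h => hG₁ x y h, ?_⟩
    simp [h4, k3, h]
  · rw [List.nodup_append]
    refine ⟨h2.map hf, k2.map hg, ?_⟩
    simp only [List.mem_map]
    rintro _ ⟨x, -, rfl⟩ _ ⟨y, -, rfl⟩
    exact hfg x y
  · simp [h3]
  · simp [k4]
  · simp [h5, k5]; omega

theorem HasPath.exists_isCycle {G : SimpleGraph V} {a b : V} {k : ℕ} (h : HasPath G a b k)
    (hk : 2 ≤ k) (hab : G.Adj b a) :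
    ∃ (v : V) (c : G.Walk v v), c.IsCycle ∧ c.length = k + 1 := by
  obtain ⟨l, h1, h2, h3, h4, h5⟩ := h
  have hne : l ≠ [] := by rintro rfl; simp at h5
  obtain rfl : l.head hne = a := by
    rw [List.head?_eq_some_head hne] at h3; exact Option.some.inj h3
  obtain rfl : l.getLast hne = b := by
    rw [List.getLast?_eq_some_getLast hne] at h4; exact Option.some.inj h4
  let p := SimpleGraph.Walk.ofSupport l hne h1
  have hlen : p.length = k := by simp [p, h5]
  have hp : p.IsPath := by
    rw [SimpleGraph.Walk.isPath_def, SimpleGraph.Walk.support_ofSupport]; exact h2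
  refine ⟨_, .cons hab p, ?_, by simp [hlen]⟩
  rw [SimpleGraph.Walk.cons_isCycle_iff]
  -- A path containing an edge between its own ends is that edge, which `hk` excludes.
  refine ⟨hp, fun hmem => ?_⟩
  have : p.length = 1 := by
    rw [Sym2.eq_swap] at hmem
    exact hp.length_eq_one_of_mem_edges hmem
  omega

theorem hasPath_of_seq {G : SimpleGraph V} (w : ℕ → V) (k : ℕ)
    (hinj : ∀ i j, i ≤ k → j ≤ k → w i = w j → i = j) (hadj : ∀ i, i < k → G.Adj (w i) (w (i + 1))) :
    HasPath G (w 0) (w k) k := by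
  refine ⟨(List.range (k + 1)).map w, ?_, ?_, ?_, ?_, by simp⟩
  · rw [List.isChain_map, List.isChain_range_succ]
    exact fun i hi => hadj i hi
  · refine List.Nodup.map_on ?_ List.nodup_range
    intro x hx y hy h
    simp only [List.mem_range] at hx hy
    exact hinj x y (by omega) (by omega) h
  · simp [List.head?_range]
  · simp [List.getLast?_range]

end Path

/-! ### Two copies joined by a matching, and decompositions -/

section Join

variable {V W : Type*}

/-- Two copies of `H`, indexed by `Bool`, and the matching joining each vertex `x` of one copy to
the vertex `f x` of the other one. -/
def join (e : Bool × V ≃ W) (H : SimpleGraph V) (f : V → V) (hf : Function.Involutive f) :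
    SimpleGraph W where
  Adj u v := ((e.symm u).1 = (e.symm v).1 ∧ H.Adj (e.symm u).2 (e.symm v).2) ∨
    ((e.symm u).1 ≠ (e.symm v).1 ∧ f (e.symm u).2 = (e.symm v).2)
  symm := ⟨by
    rintro u v (⟨h, h'⟩ | ⟨h, h'⟩)
    · exact Or.inl ⟨h.symm, h'.symm⟩
    · exact Or.inr ⟨h.symm, by rw [← h', hf]⟩⟩
  loopless := ⟨by
    rintro u (⟨_, h⟩ | ⟨h, _⟩)
    · exact H.loopless.irrefl _ h
    · exact h rfl⟩

theorem join_adj {e : Bool × V ≃ W} {H : SimpleGraph V} {f : V → V} {hf : Function.Involutive f}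
    {a b : Bool} {x y : V} : (join e H f hf).Adj (e (a, x)) (e (b, y)) ↔
      (a = b ∧ H.Adj x y) ∨ (a ≠ b ∧ f x = y) := by
  simp [join]

theorem join_adj_copy {e : Bool × V ≃ W} {H : SimpleGraph V} {f : V → V}
    {hf : Function.Involutive f} (a : Bool) (x y : V) (h : H.Adj x y) :
    (join e H f hf).Adj (e (a, x)) (e (a, y)) :=
  join_adj.2 (Or.inl ⟨rfl, h⟩)

theorem join_adj_cross {e : Bool × V ≃ W} {H : SimpleGraph V} {f : V → V}
    {hf : Function.Involutive f} (a : Bool) (x : V) :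
    (join e H f hf).Adj (e (a, x)) (e (!a, f x)) :=
  join_adj.2 (Or.inr ⟨by simp, rfl⟩)

theorem pair_injective (e : Bool × V ≃ W) (a : Bool) : Function.Injective fun x => e (a, x) :=
  fun x y h => by simpa using h

theorem forall_pair (e : Bool × V ≃ W) {p : W → Prop} (h : ∀ a x, p (e (a, x))) (w : W) : p w := by
  obtain ⟨⟨a, x⟩, rfl⟩ := e.surjective w
  exact h a x

theorem ncard_cross [Finite V] (e : Bool × V ≃ W) (a : Bool) (s t : Set V) :
    ((fun x => e (a, x)) '' s ∪ (fun x => e (!a, x)) '' t).ncard = s.ncard + t.ncard := by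
  rw [Set.ncard_union_eq, Set.ncard_image_of_injective _ (pair_injective e a),
    Set.ncard_image_of_injective _ (pair_injective e !a)]
  rw [Set.disjoint_left]
  rintro _ ⟨x, -, rfl⟩ ⟨y, -, h⟩
  simp at h

theorem IsDecomposition.adj_iff {G H₁ H₂ : SimpleGraph V} (h : IsDecomposition G H₁ H₂) (x y : V) :
    (G.Adj x y ↔ H₁.Adj x y ∨ H₂.Adj x y) ∧ ¬ (H₁.Adj x y ∧ H₂.Adj x y) := by
  obtain ⟨h1, h2⟩ := h
  constructor
  · have := Set.ext_iff.1 h1 s(x, y)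
    simpa using this.symm
  · rintro ⟨h3, h4⟩
    exact Set.disjoint_left.1 h2 (H₁.mem_edgeSet.2 h3) (H₂.mem_edgeSet.2 h4)

theorem isDecomposition_iff {G H₁ H₂ : SimpleGraph V} : IsDecomposition G H₁ H₂ ↔
    ∀ x y, (G.Adj x y ↔ H₁.Adj x y ∨ H₂.Adj x y) ∧ ¬ (H₁.Adj x y ∧ H₂.Adj x y) := by
  refine ⟨fun h => h.adj_iff, fun h => ⟨?_, ?_⟩⟩
  · ext z
    induction z with | _ x y => simpa using (h x y).1.symm
  · rw [Set.disjoint_left]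
    intro z
    induction z with | _ x y => simpa using (h x y).2

theorem IsDecomposition.symm {G H₁ H₂ : SimpleGraph V} (h : IsDecomposition G H₁ H₂) :
    IsDecomposition G H₂ H₁ :=
  ⟨by rw [Set.union_comm, h.1], h.2.symm⟩

end Join

/-! ### Degrees -/

section Regular

variable {V W : Type*} [Fintype V]

theorem isRegular_iff {G : SimpleGraph V} {k : ℕ} :
    IsRegular G k ↔ ∀ v, (G.neighborSet v).ncard = k := by
  classical
  unfold IsRegular SimpleGraph.IsRegularOfDegree
  refine forall_congr' fun v => ?_
  rw [← SimpleGraph.card_neighborSet_eq_degree, Set.ncard_eq_toFinset_card', Set.toFinset_card]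

theorem join_isRegular [Fintype W] {e : Bool × V ≃ W} {H : SimpleGraph V} {f : V → V}
    {hf : Function.Involutive f} {k : ℕ} (hH : IsRegular H k) :
    IsRegular (join e H f hf) (k + 1) := by
  rw [isRegular_iff] at hH ⊢
  refine forall_pair e fun a x => ?_
  rw [← hH x, ← Set.ncard_singleton (f x), ← ncard_cross e a]
  congr 1
  ext w
  revert w
  refine forall_pair e fun b y => ?_
  cases a <;> cases b <;> simp [join_adj, eq_comm]

theorem IsDecomposition.isRegular_right {G H₁ H₂ : SimpleGraph V} (h : IsDecomposition G H₁ H₂)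
    {k l : ℕ} (hG : IsRegular G (k + l)) (h₁ : IsRegular H₁ k) : IsRegular H₂ l := by
  rw [isRegular_iff] at *
  intro v
  have : G.neighborSet v = H₁.neighborSet v ∪ H₂.neighborSet v := by
    ext w
    simpa using (h.adj_iff v w).1
  have h' := hG v
  rw [this, Set.ncard_union_eq, h₁ v] at h'
  · omega
  · rw [Set.disjoint_left]
    exact fun w h1 h2 => (h.adj_iff v w).2 ⟨h1, h2⟩

end Regular

/-! ### Connectivity of two matched copies -/

section Connectivity

variable {V W : Type*} [Fintype V]

open Classical in
/-- The part of a vertex set lying in the copy `a`. -/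
noncomputable def slice (e : Bool × V ≃ W) (S : Finset W) (a : Bool) : Finset V :=
  Finset.univ.filter fun x => e (a, x) ∈ S

theorem mem_slice {e : Bool × V ≃ W} {S : Finset W} {a : Bool} {x : V} :
    x ∈ slice e S a ↔ e (a, x) ∈ S := by
  simp [slice]

theorem card_slice_add (e : Bool × V ≃ W) (S : Finset W) (a : Bool) :
    (slice e S a).card + (slice e S !a).card = S.card := by
  rw [← Set.ncard_coe_finset, ← Set.ncard_coe_finset, ← Set.ncard_coe_finset, ← ncard_cross e a]
  congr 1
  ext w
  revert w
  refine forall_pair e fun b y => ?_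
  cases a <;> cases b <;> simp [mem_slice]

/-- Two `k`-connected graphs joined by a perfect matching stay connected after the deletion of `S`
if, whenever at least `k` vertices are deleted from one copy, fewer are deleted from the other one
and each vertex of the first copy is still linked to the second one. -/
theorem induce_compl_connected {e : Bool × V ≃ W} {H : SimpleGraph V} {G : SimpleGraph W} {k : ℕ}
    (hH : IsKConnected H k) (hcopy : ∀ a x y, H.Adj x y → G.Adj (e (a, x)) (e (a, y)))
    (f : Equiv.Perm V) (hcross : ∀ x, G.Adj (e (false, x)) (e (true, f x)))
    (S : Finset W) (hS : S.card < Fintype.card V)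
    (hlarge : ∀ a, k ≤ (slice e S a).card → (slice e S !a).card < k ∧
      ∀ x, (hx : e (a, x) ∉ S) → ∃ y, ∃ hy : e (!a, y) ∉ S,
        (G.induce ((S : Set W)ᶜ)).Reachable ⟨e (a, x), by simpa⟩ ⟨e (!a, y), by simpa⟩) :
    (G.induce ((S : Set W)ᶜ)).Connected := by
  classical
  have hom (a : Bool) (x y : V) (hx : e (a, x) ∉ S) (hy : e (a, y) ∉ S)
      (h : (slice e S a).card < k) :
      (G.induce ((S : Set W)ᶜ)).Reachable ⟨e (a, x), by simpa⟩ ⟨e (a, y), by simpa⟩ := by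
    have hc := (hH.2 _ h).preconnected ⟨x, by simpa [mem_slice]⟩ ⟨y, by simpa [mem_slice]⟩
    let φ : H.induce ((slice e S a : Set V)ᶜ) →g G.induce ((S : Set W)ᶜ) :=
      { toFun := fun z => ⟨e (a, z.1), fun hz => z.2 (mem_slice.2 hz)⟩
        map_rel' := fun {u v} h => hcopy a u v h }
    exact hc.map φ
  have key (a : Bool) (h : (slice e S !a).card < k)
      (hr : ∀ x, (hx : e (a, x) ∉ S) → ∃ y, ∃ hy : e (!a, y) ∉ S,
        (G.induce ((S : Set W)ᶜ)).Reachable ⟨e (a, x), by simpa⟩ ⟨e (!a, y), by simpa⟩) :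
      (G.induce ((S : Set W)ᶜ)).Connected := by
    obtain ⟨⟨x₀, hx₀⟩⟩ := (hH.2 _ h).nonempty
    have hx₀ : e (!a, x₀) ∉ S := by simpa [mem_slice] using hx₀
    rw [SimpleGraph.connected_iff_exists_forall_reachable]
    refine ⟨⟨e (!a, x₀), by simpa⟩, ?_⟩
    rintro ⟨w, hw⟩
    obtain ⟨⟨b, x⟩, rfl⟩ := e.surjective w
    have hx : e (b, x) ∉ S := by simpa using hw
    by_cases hb : b = a
    · subst hb
      obtain ⟨y, hy, hxy⟩ := hr x hx
      exact (hom _ _ _ hx₀ hy h).trans hxy.symm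
    · obtain rfl : b = !a := by cases a <;> cases b <;> simp_all
      exact hom _ _ _ hx₀ hx h
  by_cases h0 : k ≤ (slice e S false).card
  · exact key false (hlarge false h0).1 (hlarge false h0).2
  by_cases h1 : k ≤ (slice e S true).card
  · exact key true (hlarge true h1).1 (hlarge true h1).2
  push Not at h0 h1
  -- Both copies stay connected, so one intact matching edge suffices. Each deleted vertex spoils
  -- only one matching edge, recorded by its end in the copy `false`, and `S` has fewer vertices
  -- than there are edges.
  obtain ⟨x₁, hx₁, hx₂⟩ : ∃ x, e (false, x) ∉ S ∧ e (true, f x) ∉ S := by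
    by_contra! hcon
    have : (Finset.univ : Finset V) ⊆
        S.image fun w => if (e.symm w).1 then f.symm (e.symm w).2 else (e.symm w).2 := by
      intro x _
      rw [Finset.mem_image]
      by_cases hx : e (false, x) ∈ S
      · exact ⟨_, hx, by simp⟩
      · exact ⟨_, hcon x hx, by simp⟩
    have := (Finset.card_le_card this).trans Finset.card_image_le
    rw [Finset.card_univ] at this
    omega
  refine key false h1 fun x hx => ⟨f x₁, hx₂, (hom _ _ _ hx hx₁ h0).trans ?_⟩
  exact SimpleGraph.Adj.reachable (hcross x₁)

variable [Fintype W]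

theorem card_eq_two_mul (e : Bool × V ≃ W) : Fintype.card W = 2 * Fintype.card V := by
  rw [← Fintype.card_congr e]; simp

/-- At most k vertices are deleted, so if one copy loses k of them the other is intact, and each
survivor keeps its matching edge. -/
theorem IsKConnected.of_matching {e : Bool × V ≃ W} {H : SimpleGraph V} {G : SimpleGraph W} {k : ℕ}
    (hH : IsKConnected H k) (hk : 1 ≤ k)
    (hcopy : ∀ a x y, H.Adj x y → G.Adj (e (a, x)) (e (a, y)))
    (f : Equiv.Perm V) (hcross : ∀ x, G.Adj (e (false, x)) (e (true, f x))) :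
    IsKConnected G (k + 1) := by
  have hk' := hH.1
  refine ⟨by rw [card_eq_two_mul e]; omega, fun S hS => ?_⟩
  refine induce_compl_connected hH hcopy f hcross S (by omega) fun a ha => ?_
  have hcard := card_slice_add e S a
  refine ⟨by omega, fun x hx => ?_⟩
  have hempty : slice e S (!a) = ∅ := by rw [← Finset.card_eq_zero]; omega
  have hout (y : V) : e (!a, y) ∉ S := by rw [← mem_slice, hempty]; simp
  cases a
  · exact ⟨f x, hout _, SimpleGraph.Adj.reachable (hcross x)⟩
  · refine ⟨f.symm x, hout _, SimpleGraph.Adj.reachable ?_⟩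
    have := (hcross (f.symm x)).symm
    rwa [Equiv.apply_symm_apply] at this

theorem join_isKConnected {e : Bool × V ≃ W} {H : SimpleGraph V} {f : V → V}
    {hf : Function.Involutive f} {k : ℕ} (hH : IsKConnected H k) (hk : 1 ≤ k) :
    IsKConnected (join e H f hf) (k + 1) :=
  hH.of_matching hk (fun a x y => join_adj_copy a x y) (hf.toPerm f) fun x => join_adj_cross false x

end Connectivity

/-! ### Cycle lengths in two matched copies -/

section Pancyclic

variable {V W : Type*}

/-- `c` and `b` are joined by paths of all odd lengths and by a path missing just one vertex. -/
def Rung [Fintype V] (G : SimpleGraph V) (c b : V) : Prop :=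
  (∀ k, Odd k → k < Fintype.card V → HasPath G c b k) ∧ HasPath G c b (Fintype.card V - 2)

theorem Rung.map [Fintype V] {G : SimpleGraph V} {f : V → V} (hf : Function.Injective f)
    (hG : ∀ x y, G.Adj x y → G.Adj (f x) (f y)) {c b : V} (h : Rung G c b) : Rung G (f c) (f b) :=
  ⟨fun k h1 h2 => (h.1 k h1 h2).map hf hG, h.2.map hf hG⟩

variable {e : Bool × V ≃ W} {H : SimpleGraph V} {G : SimpleGraph W}

theorem HasPath.cross (hcopy : ∀ a x y, H.Adj x y → G.Adj (e (a, x)) (e (a, y)))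
    {a b c d : V} {i j : ℕ} (h₀ : HasPath H a b i) (h₁ : HasPath H c d j)
    (h : G.Adj (e (false, b)) (e (true, c))) :
    HasPath G (e (false, a)) (e (true, d)) (i + j + 1) :=
  h₀.append (pair_injective e false) (pair_injective e true) (by simp) (hcopy false) (hcopy true)
    h₁ h

variable [Fintype V]

theorem Rung.exists_even_isCycle {G : SimpleGraph V} {c b : V} (h : Rung G c b)
    (hcb : G.Adj b c) {l : ℕ} (hl : Even l) (h4 : 4 ≤ l) (hle : l ≤ Fintype.card V) :
    ∃ (v : V) (p : G.Walk v v), p.IsCycle ∧ p.length = l := by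
  obtain ⟨t, rfl⟩ := hl
  have := (h.1 (2 * (t - 1) + 1) ⟨_, rfl⟩ (by omega)).exists_isCycle (by omega) hcb
  convert this using 6
  omega

/-- The path runs from c to b in one copy, crosses at b, and returns from b' to c' in the other. Two
odd lengths and the crossing give every odd total above 1; a path missing one vertex followed by a
Hamiltonian one misses one vertex overall. -/
theorem Rung.of_matching [Fintype W] (hcopy : ∀ a x y, H.Adj x y → G.Adj (e (a, x)) (e (a, y)))
    {c b c' b' : V} (heven : Even (Fintype.card V))
    (hc : G.Adj (e (false, c)) (e (true, c'))) (hb : G.Adj (e (false, b)) (e (true, b')))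
    (h : Rung H c b) (h' : Rung H c' b') : Rung G (e (false, c)) (e (true, c')) := by
  have hpos : 0 < Fintype.card V := Fintype.card_pos_iff.2 ⟨c⟩
  obtain ⟨m, hm⟩ := heven
  rw [Rung, card_eq_two_mul e]
  constructor
  · rintro k ⟨t, rfl⟩ hk
    rcases t.eq_zero_or_pos with rfl | ht
    · exact hasPath_one hc
    by_cases hle : t ≤ m
    · have := (h.1 (2 * (t - 1) + 1) ⟨_, rfl⟩ (by omega)).cross hcopy
        (h'.1 1 (by simp) (by omega)).symm hb
      convert this using 1
      omega
    · have := (h.1 (2 * (m - 1) + 1) ⟨_, rfl⟩ (by omega)).cross hcopy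
        (h'.1 (2 * (t - m) + 1) ⟨_, rfl⟩ (by omega)).symm hb
      convert this using 1
      omega
  · have := h.2.cross hcopy (h'.1 (2 * (m - 1) + 1) ⟨_, rfl⟩ (by omega)).symm hb
    convert this using 1
    omega

theorem IsPancyclicFrom.of_matching [Fintype W]
    (hcopy : ∀ a x y, H.Adj x y → G.Adj (e (a, x)) (e (a, y)))
    {c b c' b' : V} (heven : Even (Fintype.card V)) (hcard : 4 ≤ Fintype.card V)
    (hc : G.Adj (e (false, c)) (e (true, c'))) (hb : G.Adj (e (false, b)) (e (true, b')))
    (h : Rung H c b) (h' : Rung H c' b') (hH : IsPancyclicFrom H 4) : IsPancyclicFrom G 4 := by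
  intro l h4 hl
  rcases Nat.even_or_odd l with hl' | hl'
  · exact (Rung.of_matching hcopy heven hc hb h h').exists_even_isCycle hc.symm hl' h4 hl
  rw [card_eq_two_mul e] at hl
  by_cases hle : l ≤ Fintype.card V
  · obtain ⟨v, p, hp, rfl⟩ := hH l h4 hle
    let φ : H →g G := ⟨fun x => e (false, x), fun {x y} h => hcopy false x y h⟩
    exact ⟨_, p.map φ, hp.map (pair_injective e false), by simp⟩
  -- An odd cycle too long for one copy: the even path missing one vertex, an odd path of the other
  -- copy, and the matching edges at b and c.
  · obtain ⟨t, rfl⟩ := hl'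
    obtain ⟨m, hm⟩ := heven
    have := (h.2.cross hcopy (h'.1 (2 * (t - m) + 1) ⟨_, rfl⟩ (by omega)).symm hb).exists_isCycle
      (by omega) hc.symm
    convert this using 6
    omega

end Pancyclic

/-! ### Recursion and complementation in the augmented cube -/

/-- A string of length `n + 1` is a symbol followed by a string of length `n`. -/
def consEquiv (n : ℕ) : Bool × (Fin n → Bool) ≃ (Fin (n + 1) → Bool) :=
  Fin.consEquiv fun _ => Bool

theorem compl_consEquiv {n : ℕ} (a : Bool) (x : Fin n → Bool) :
    (consEquiv n (a, x))ᶜ = consEquiv n (!a, xᶜ) := by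
  ext i
  refine Fin.cases ?_ (fun i => ?_) i <;> simp [consEquiv, Fin.consEquiv]

theorem augmentedCube_adj {n : ℕ} {a b : Bool} {x y : Fin n → Bool} :
    (augmentedCube (n + 1)).Adj (consEquiv n (a, x)) (consEquiv n (b, y)) ↔
      (a = b ∧ (augmentedCube n).Adj x y) ∨ (a ≠ b ∧ (y = x ∨ y = xᶜ)) := by
  have : (∀ i, x i = !y i) ↔ y = xᶜ := by
    rw [eq_compl_comm, funext_iff]; rfl
  simp [augmentedCube, consEquiv, Fin.consEquiv, this, eq_comm (a := x)]

theorem ne_compl {n : ℕ} (hn : n ≠ 0) (x : Fin n → Bool) : x ≠ xᶜ := by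
  intro h
  have := congrFun h ⟨0, by omega⟩
  simp at this

theorem augmentedCube_compl {n : ℕ} {x y : Fin n → Bool} (h : (augmentedCube n).Adj x y) :
    (augmentedCube n).Adj xᶜ yᶜ := by
  induction n with
  | zero => exact absurd h (by simp [augmentedCube])
  | succ n ih =>
    obtain ⟨⟨a, x⟩, rfl⟩ := (consEquiv n).surjective x
    obtain ⟨⟨b, y⟩, rfl⟩ := (consEquiv n).surjective y
    simp only [compl_consEquiv, augmentedCube_adj] at h ⊢
    rcases h with (⟨rfl, h⟩ | ⟨h, rfl | rfl⟩)
    · exact Or.inl ⟨rfl, ih h⟩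
    · exact Or.inr ⟨by simpa using h, Or.inl rfl⟩
    · exact Or.inr ⟨by simpa using h, Or.inr rfl⟩

theorem augmentedCube_adj_compl {n : ℕ} (hn : n ≠ 0) (x : Fin n → Bool) :
    (augmentedCube n).Adj x xᶜ := by
  obtain ⟨n, rfl⟩ := Nat.exists_eq_succ_of_ne_zero hn
  revert x
  refine forall_pair (consEquiv n) fun a x => ?_
  rw [compl_consEquiv, augmentedCube_adj]
  simp

theorem augmentedCube_isRegular (n : ℕ) : IsRegular (augmentedCube (n + 1)) (2 * n + 1) := by
  induction n with
  | zero =>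
    rw [isRegular_iff, zero_add, augmentedCube_one]
    intro v
    have h : (⊤ : SimpleGraph (Fin 1 → Bool)).neighborSet v = {vᶜ} := by
      ext w
      rw [SimpleGraph.mem_neighborSet, SimpleGraph.top_adj, Set.mem_singleton_iff, funext_iff,
        Ne, funext_iff]
      simp [Fin.forall_fin_one]
      cases v 0 <;> cases w 0 <;> simp
    simp [h]
  | succ n ih =>
    rw [isRegular_iff] at ih ⊢
    refine forall_pair (consEquiv _) fun a x => ?_
    rw [show 2 * (n + 1) + 1 = (2 * n + 1) + 2 by ring, ← ih x,
      ← Set.ncard_pair (ne_compl n.succ_ne_zero x), ← ncard_cross (consEquiv _) a]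
    congr 1
    ext w
    revert w
    refine forall_pair (consEquiv _) fun b y => ?_
    rw [SimpleGraph.mem_neighborSet, augmentedCube_adj]
    cases a <;> cases b <;> simp [eq_comm]

/-- At each x the two cross edges go to x and xᶜ, which differ since n ≠ 0. One factor may choose
either of them vertex by vertex, as long as the other takes the opposite one. -/
theorem join_isDecomposition {n : ℕ} {H₁ H₂ : SimpleGraph (Fin n → Bool)}
    (h : IsDecomposition (augmentedCube n) H₁ H₂) {f g : (Fin n → Bool) → Fin n → Bool}
    (hf : Function.Involutive f) (hg : Function.Involutive g) (hn : n ≠ 0)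
    (hfx : ∀ x, f x = x ∨ f x = xᶜ) (hgf : ∀ x, g x = (f x)ᶜ) :
    IsDecomposition (augmentedCube (n + 1)) (join (consEquiv n) H₁ f hf)
      (join (consEquiv n) H₂ g hg) := by
  rw [isDecomposition_iff] at h ⊢
  refine forall_pair (consEquiv n) fun a x => forall_pair (consEquiv n) fun b y => ?_
  simp only [augmentedCube_adj, join_adj, hgf]
  by_cases hab : a = b
  · simpa [hab] using h x y
  · have := ne_compl hn x
    rcases hfx x with h' | h' <;> rw [h'] <;> simp only [hab, false_and, ne_eq, not_false_eq_true,
      true_and, false_or, eq_comm (a := y), compl_compl]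
    · exact fun h => this (h.1.trans h.2.symm)
    · exact ⟨or_comm, fun h => this (h.2.trans h.1.symm)⟩

/-! ### Binary expansions and the counting cycle -/

/-- The number of which a string is the binary expansion. -/
def num : (n : ℕ) → (Fin n → Bool) → ℕ
  | 0, _ => 0
  | n + 1, x => (x 0).toNat * 2 ^ n + num n (Fin.tail x)

/-- The string of the last `n` binary digits of a number. -/
def str : (n : ℕ) → ℕ → (Fin n → Bool)
  | 0, _ => fun _ => false
  | n + 1, i => consEquiv n (i.testBit n, str n i)

theorem num_consEquiv {n : ℕ} (a : Bool) (x : Fin n → Bool) :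
    num (n + 1) (consEquiv n (a, x)) = a.toNat * 2 ^ n + num n x := by
  simp [num, consEquiv, Fin.consEquiv]

theorem num_lt (n : ℕ) (x : Fin n → Bool) : num n x < 2 ^ n := by
  induction n with
  | zero => simp [num]
  | succ n ih =>
    revert x
    refine forall_pair (consEquiv n) fun a x => ?_
    have := ih x
    rw [num_consEquiv, pow_succ]
    cases a <;> simp <;> omega

theorem num_str (n i : ℕ) : num n (str n i) = i % 2 ^ n := by
  induction n with
  | zero => simp [num, Nat.mod_one]
  | succ n ih =>
    rw [str, num_consEquiv, ih, Nat.mod_pow_succ, Nat.toNat_testBit]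
    ring

theorem num_injective (n : ℕ) : Function.Injective (num n) := by
  induction n with
  | zero => exact fun x y _ => Subsingleton.elim x y
  | succ n ih =>
    refine forall_pair (consEquiv n) fun a x => forall_pair (consEquiv n) fun b y => ?_
    have hx := num_lt n x
    have hy := num_lt n y
    simp only [num_consEquiv]
    intro h
    cases a <;> cases b <;> simp at h ⊢
    · exact ih h
    · omega
    · omega
    · exact ih h

theorem str_num (n : ℕ) (x : Fin n → Bool) : str n (num n x) = x := by
  apply num_injective
  rw [num_str, Nat.mod_eq_of_lt (num_lt n x)]

theorem num_str_of_lt {n i : ℕ} (h : i < 2 ^ n) : num n (str n i) = i := by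
  rw [num_str, Nat.mod_eq_of_lt h]

theorem str_eq_iff {n i : ℕ} {x : Fin n → Bool} : str n i = x ↔ i % 2 ^ n = num n x := by
  rw [← (num_injective n).eq_iff, num_str]

theorem num_compl (n : ℕ) (x : Fin n → Bool) : num n xᶜ + num n x + 1 = 2 ^ n := by
  induction n with
  | zero => simp [num]
  | succ n ih =>
    revert x
    refine forall_pair (consEquiv n) fun a x => ?_
    have := ih x
    rw [compl_consEquiv, num_consEquiv, num_consEquiv, pow_succ]
    cases a <;> simp <;> omega

theorem eq_compl_iff {n : ℕ} {x y : Fin n → Bool} : y = xᶜ ↔ num n y + num n x + 1 = 2 ^ n := by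
  have := num_compl n x
  rw [← (num_injective n).eq_iff]
  omega

/-- The cycle running through all strings in the order of the numbers that they represent. -/
def countingCycle (n : ℕ) : SimpleGraph (Fin n → Bool) where
  Adj x y := x ≠ y ∧ ((num n y = num n x + 1 ∨ (num n x + 1 = 2 ^ n ∧ num n y = 0)) ∨
    (num n x = num n y + 1 ∨ (num n y + 1 = 2 ^ n ∧ num n x = 0)))
  symm := ⟨fun _ _ h => ⟨h.1.symm, h.2.symm⟩⟩
  loopless := ⟨fun _ h => h.1 rfl⟩

theorem countingCycle_adj {n : ℕ} {x y : Fin n → Bool} : (countingCycle n).Adj x y ↔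
    num n x ≠ num n y ∧ ((num n y = num n x + 1 ∨ (num n x + 1 = 2 ^ n ∧ num n y = 0)) ∨
    (num n x = num n y + 1 ∨ (num n y + 1 = 2 ^ n ∧ num n x = 0))) := by
  rw [(num_injective n).ne_iff]; rfl

theorem countingCycle_compl {n : ℕ} {x y : Fin n → Bool} (h : (countingCycle n).Adj x y) :
    (countingCycle n).Adj xᶜ yᶜ := by
  rw [countingCycle_adj] at *
  have := num_compl n x
  have := num_compl n y
  omega

theorem countingCycle_le (n : ℕ) : countingCycle n ≤ augmentedCube n := by
  induction n with
  | zero => exact fun x y h => absurd (Subsingleton.elim x y) h.1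
  | succ n ih =>
    intro x y
    revert x y
    refine forall_pair (consEquiv n) fun a x => forall_pair (consEquiv n) fun b y => ?_
    intro h
    rw [augmentedCube_adj]
    rw [countingCycle_adj] at h
    simp only [num_consEquiv] at h
    rw [pow_succ] at h
    have hx := num_lt n x
    have hy := num_lt n y
    by_cases hab : a = b
    · refine Or.inl ⟨hab, ih (countingCycle_adj.2 ?_)⟩
      subst hab
      cases a <;> simp at h <;> omega
    -- The cycle changes copies only between 2^n - 1 and 2^n and at the wrap-around; both are
    -- complementary edges.
    · refine Or.inr ⟨hab, Or.inr (eq_compl_iff.2 ?_)⟩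
      cases a <;> cases b <;> simp at h hab <;> omega

theorem countingCycle_adj_str {n : ℕ} (hn : n ≠ 0) (i : ℕ) :
    (countingCycle n).Adj (str n i) (str n (i + 1)) := by
  have h2 : 1 < 2 ^ n := Nat.one_lt_two_pow hn
  have hi := Nat.mod_lt i (Nat.two_pow_pos n)
  rw [countingCycle_adj, num_str, num_str, Nat.add_mod, Nat.mod_eq_of_lt h2]
  by_cases h : i % 2 ^ n + 1 = 2 ^ n
  · rw [h, Nat.mod_self]; omega
  · rw [Nat.mod_eq_of_lt (a := i % 2 ^ n + 1) (by omega)]; omega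

theorem card_strings (n : ℕ) : Fintype.card (Fin n → Bool) = 2 ^ n := by simp

theorem even_two_pow {n : ℕ} (hn : n ≠ 0) : Even (2 ^ n) := by
  simp [Nat.even_pow, hn]

theorem eight_le_two_pow {n : ℕ} (hn : 3 ≤ n) : 8 ≤ 2 ^ n :=
  Nat.pow_le_pow_right (n := 2) (by norm_num) hn

theorem countingCycle_isRegular {n : ℕ} (hn : 2 ≤ n) : IsRegular (countingCycle n) 2 := by
  have h4 : 4 ≤ 2 ^ n := Nat.pow_le_pow_right (n := 2) (by norm_num) hn
  rw [isRegular_iff]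
  intro x
  have hx := num_lt n x
  let s := if num n x + 1 = 2 ^ n then 0 else num n x + 1
  let p := if num n x = 0 then 2 ^ n - 1 else num n x - 1
  have hs : num n (str n s) = s := num_str_of_lt (by simp only [s]; split_ifs <;> omega)
  have hp : num n (str n p) = p := num_str_of_lt (by simp only [p]; split_ifs <;> omega)
  have : (countingCycle n).neighborSet x = {str n s, str n p} := by
    ext y
    have hy := num_lt n y
    rw [SimpleGraph.mem_neighborSet, countingCycle_adj, Set.mem_insert_iff, Set.mem_singleton_iff,
      ← (num_injective n).eq_iff, ← (num_injective n).eq_iff, hs, hp]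
    simp only [s, p]
    split_ifs <;> omega
  rw [this, Set.ncard_pair]
  rw [← (num_injective n).ne_iff, hs, hp]
  simp only [s, p]
  split_ifs <;> omega

theorem countingCycle_isKConnected {n : ℕ} (hn : 2 ≤ n) : IsKConnected (countingCycle n) 2 := by
  have h4 : 4 ≤ 2 ^ n := Nat.pow_le_pow_right (n := 2) (by norm_num) hn
  refine ⟨by rw [card_strings]; omega, fun S hS => ?_⟩
  obtain ⟨s, hs⟩ := Finset.card_le_one_iff_subset_singleton.1 (Nat.lt_succ_iff.1 hS)
  have hns := num_lt n s
  have hout (k : ℕ) (hk : k + 1 < 2 ^ n) : str n (num n s + 1 + k) ∉ S := by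
    intro hmem
    have := Finset.mem_singleton.1 (hs hmem)
    rw [str_eq_iff] at this
    have hmod : (num n s + 1 + k) % 2 ^ n = (num n s + 0) % 2 ^ n := by
      rw [this, Nat.add_zero, Nat.mod_eq_of_lt hns]
    rw [add_assoc] at hmod
    have := Nat.ModEq.add_left_cancel' _ hmod
    rw [Nat.ModEq, Nat.zero_mod, Nat.mod_eq_of_lt (by omega)] at this
    omega
  rw [SimpleGraph.connected_iff_exists_forall_reachable]
  refine ⟨⟨str n (num n s + 1), by simpa using hout 0 (by omega)⟩, ?_⟩
  have key (k : ℕ) (hk : k + 1 < 2 ^ n) :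
      ((countingCycle n).induce ((S : Set (Fin n → Bool))ᶜ)).Reachable
        ⟨str n (num n s + 1), by simpa using hout 0 (by omega)⟩
        ⟨str n (num n s + 1 + k), by simpa using hout k hk⟩ := by
    induction k with
    | zero => exact SimpleGraph.Reachable.refl _
    | succ k ih =>
      exact (ih (by omega)).trans
        (SimpleGraph.Adj.reachable (countingCycle_adj_str (by omega) (num n s + 1 + k)))
  rintro ⟨x, hx⟩
  have hnx := num_lt n x
  by_cases hxs : x = s
  -- When nothing is deleted, `s` itself survives and is adjacent to the base point.
  · refine SimpleGraph.Adj.reachable ?_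
    have := countingCycle_adj_str (n := n) (by omega) (num n s)
    rw [str_num] at this
    simpa [hxs] using this.symm
  · have hne : num n x ≠ num n s := (num_injective n).ne hxs
    obtain ⟨k, hk, hkx⟩ : ∃ k, k + 1 < 2 ^ n ∧ (num n s + 1 + k) % 2 ^ n = num n x := by
      by_cases hlt : num n s < num n x
      · exact ⟨num n x - num n s - 1, by omega, by
          rw [← Nat.mod_eq_of_lt hnx]; congr 1; rw [Nat.mod_eq_of_lt hnx]; omega⟩
      · refine ⟨num n x + 2 ^ n - num n s - 1, by omega, ?_⟩
        rw [show num n s + 1 + (num n x + 2 ^ n - num n s - 1) = num n x + 2 ^ n by omega,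
          Nat.add_mod_right, Nat.mod_eq_of_lt hnx]
    have := key k hk
    convert this using 2
    exact (str_eq_iff.2 hkx).symm

/-- As `str` reduces modulo 2^n, the arc may pass through the wrap-around. -/
theorem countingCycle_hasPath {n : ℕ} (hn : n ≠ 0) (i d : ℕ) (hd : d < 2 ^ n) :
    HasPath (countingCycle n) (str n i) (str n (i + d)) d := by
  refine hasPath_of_seq (fun k => str n (i + k)) d (fun j k hj hk h => ?_)
    fun k _ => countingCycle_adj_str hn (i + k)
  rw [str_eq_iff, num_str] at h
  have := Nat.ModEq.add_left_cancel' _ h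
  rwa [Nat.ModEq, Nat.mod_eq_of_lt (by omega), Nat.mod_eq_of_lt (by omega)] at this

/-! ### The complement of the counting cycle -/

instance decidableAugmentedCubeAdj : (n : ℕ) → DecidableRel (augmentedCube n).Adj
  | 0 => fun _ _ => isFalse id
  | n + 1 => fun x y =>
    haveI := decidableAugmentedCubeAdj n
    inferInstanceAs (Decidable ((x 0 = y 0 ∧ (augmentedCube n).Adj (Fin.tail x) (Fin.tail y)) ∨
        (x 0 ≠ y 0 ∧
          (Fin.tail x = Fin.tail y ∨ ∀ i : Fin n, Fin.tail x i = !(Fin.tail y i)))))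

instance decidableCountingCycleAdj (n : ℕ) : DecidableRel (countingCycle n).Adj :=
  fun _ _ => decidable_of_iff' _ countingCycle_adj

/-- The graph of the edges of the augmented cube outside the counting cycle. -/
def cocycle (n : ℕ) : SimpleGraph (Fin n → Bool) := augmentedCube n \ countingCycle n

theorem cocycle_adj {n : ℕ} {x y : Fin n → Bool} :
    (cocycle n).Adj x y ↔ (augmentedCube n).Adj x y ∧ ¬ (countingCycle n).Adj x y :=
  SimpleGraph.sdiff_adj ..

instance decidableCocycleAdj (n : ℕ) : DecidableRel (cocycle n).Adj :=
  fun _ _ => decidable_of_iff' _ cocycle_adj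

/-- Complementation is i ↦ 2^n - 1 - i, a reflection of the counting cycle. The symmetry is needed
to carry a rung across a complementary matching. -/
theorem cocycle_compl {n : ℕ} {x y : Fin n → Bool} (h : (cocycle n).Adj x y) :
    (cocycle n).Adj xᶜ yᶜ := by
  rw [cocycle_adj] at *
  refine ⟨augmentedCube_compl h.1, fun h' => h.2 ?_⟩
  simpa using countingCycle_compl h'

theorem isDecomposition_cocycle (n : ℕ) :
    IsDecomposition (augmentedCube n) (countingCycle n) (cocycle n) := by
  rw [isDecomposition_iff]
  intro x y
  have := @countingCycle_le n x y
  rw [cocycle_adj]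
  tauto

theorem cocycle_isRegular (n : ℕ) : IsRegular (cocycle (n + 2)) (2 * n + 1) :=
  (isDecomposition_cocycle (n + 2)).isRegular_right
    (by convert augmentedCube_isRegular (n + 1) using 1; ring)
    (countingCycle_isRegular (by omega))

theorem cocycle_adj_copy {n : ℕ} (a : Bool) (x y : Fin n → Bool) (h : (cocycle n).Adj x y) :
    (cocycle (n + 1)).Adj (consEquiv n (a, x)) (consEquiv n (a, y)) := by
  rw [cocycle_adj] at *
  refine ⟨augmentedCube_adj.2 (Or.inl ⟨rfl, h.1⟩), fun h' => h.2 ?_⟩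
  rw [countingCycle_adj] at *
  simp only [num_consEquiv] at h'
  rw [pow_succ] at h'
  have hx := num_lt n x
  have hy := num_lt n y
  cases a <;> simp at h' <;> omega

theorem cocycle_adj_cross {n : ℕ} (hn : n ≠ 0) (a : Bool) (x : Fin n → Bool) :
    (cocycle (n + 1)).Adj (consEquiv n (a, x)) (consEquiv n (!a, x)) := by
  rw [cocycle_adj, augmentedCube_adj]
  refine ⟨Or.inr ⟨by simp, Or.inl rfl⟩, fun h => ?_⟩
  rw [countingCycle_adj] at h
  simp only [num_consEquiv] at h
  rw [pow_succ] at h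
  have hx := num_lt n x
  have := Nat.one_lt_two_pow hn
  cases a <;> simp at h <;> omega

theorem cocycle_adj_cross_compl {n : ℕ} (a : Bool) (x : Fin n → Bool) (h0 : num n x ≠ 0)
    (h1 : num n x + 1 ≠ 2 ^ n) :
    (cocycle (n + 1)).Adj (consEquiv n (a, x)) (consEquiv n (!a, xᶜ)) := by
  rw [cocycle_adj, augmentedCube_adj]
  refine ⟨Or.inr ⟨by simp, Or.inr rfl⟩, fun h => ?_⟩
  rw [countingCycle_adj] at h
  simp only [num_consEquiv] at h
  rw [pow_succ] at h
  have hx := num_lt n x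
  have := num_compl n x
  cases a <;> simp at h <;> omega

/-- The larger counting cycle drops the closing edge of the smaller one in each copy. This
compensates the ends for the complementary cross edges they lose to it. -/
theorem cocycle_adj_closing {n : ℕ} (hn : 2 ≤ n) (a : Bool) (x : Fin n → Bool)
    (h01 : num n x = 0 ∨ num n x + 1 = 2 ^ n) :
    (cocycle (n + 1)).Adj (consEquiv n (a, x)) (consEquiv n (a, xᶜ)) ∧ ¬ (cocycle n).Adj x xᶜ := by
  have h4 : 4 ≤ 2 ^ n := Nat.pow_le_pow_right (n := 2) (by norm_num) hn
  have := num_compl n x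
  rw [cocycle_adj, cocycle_adj, augmentedCube_adj]
  refine ⟨⟨Or.inl ⟨rfl, augmentedCube_adj_compl (by omega) x⟩, fun h => ?_⟩, fun h => h.2 ?_⟩
  · rw [countingCycle_adj] at h
    simp only [num_consEquiv] at h
    rw [pow_succ] at h
    cases a <;> simp at h <;> omega
  · rw [countingCycle_adj]
    omega

/-- Splitting by the last digit shows 4-cycles on the even and on the odd numbers, with a perfect
matching between them. The default 0 of `getD` is never reached, as `num 2` is below 4. -/
theorem cocycle_three_isKConnected : IsKConnected (cocycle 3) 3 := by
  let g : Bool × (Fin 2 → Bool) → (Fin 3 → Bool) := fun p =>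
    str 3 ([0, 2, 6, 4].getD (num 2 p.2) 0 + p.1.toNat)
  let f : (Fin 2 → Bool) → (Fin 2 → Bool) := fun x => str 2 ([1, 3, 0, 2].getD (num 2 x) 0)
  refine (countingCycle_isKConnected le_rfl).of_matching (by norm_num)
    (e := Equiv.ofBijective g (by decide +kernel)) ?_ (Equiv.ofBijective f (by decide +kernel)) ?_
  · change ∀ a x y, (countingCycle 2).Adj x y → (cocycle 3).Adj (g (a, x)) (g (a, y))
    decide +kernel
  · change ∀ x, (cocycle 3).Adj (g (false, x)) (g (true, f x))
    decide +kernel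

theorem cocycle_isKConnected_succ {n k : ℕ} (hn : 2 ≤ n) (hk : 2 ≤ k) (hkn : k + 1 < 2 ^ n)
    (hreg : IsRegular (cocycle n) k) (hconn : IsKConnected (cocycle n) k) :
    IsKConnected (cocycle (n + 1)) (k + 2) := by
  have hn0 : n ≠ 0 := by omega
  refine ⟨by rw [card_strings, pow_succ]; omega, fun S hS => ?_⟩
  refine induce_compl_connected hconn cocycle_adj_copy (Equiv.refl _)
    (fun x => cocycle_adj_cross hn0 false x) S (by rw [card_strings]; omega) fun a ha => ?_
  have hcard := card_slice_add (consEquiv n) S a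
  refine ⟨by omega, fun x hx => ?_⟩
  by_cases h : consEquiv n (!a, x) ∈ S
  swap
  · exact ⟨x, h, SimpleGraph.Adj.reachable (cocycle_adj_cross hn0 a x)⟩
  have hone : ∀ y, y ≠ x → consEquiv n (!a, y) ∉ S := by
    intro y hy hyS
    have := Finset.card_le_one.1 (by omega : (slice (consEquiv n) S !a).card ≤ 1) y
      (mem_slice.2 hyS) x (mem_slice.2 h)
    exact hy this
  by_cases h01 : num n x = 0 ∨ num n x + 1 = 2 ^ n
  swap
  · push Not at h01
    exact ⟨xᶜ, hone _ (ne_compl hn0 x).symm,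
      SimpleGraph.Adj.reachable (cocycle_adj_cross_compl a x h01.1 h01.2)⟩
  -- Here x is an end and its deleted partner is the only vertex missing from the other copy. The
  -- copy of x has lost at most k vertices, while x has k + 1 neighbours in it, counting the closing
  -- edge; a surviving neighbour crosses over.
  obtain ⟨hclose, hnot⟩ := cocycle_adj_closing hn a x h01
  have hpos : 0 < (slice (consEquiv n) S !a).card := Finset.card_pos.2 ⟨x, mem_slice.2 h⟩
  have hN : (insert xᶜ ((cocycle n).neighborSet x)).ncard = k + 1 := by
    rw [Set.ncard_insert_of_notMem (by simpa using hnot), isRegular_iff.1 hreg x]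
  obtain ⟨z, hz, hzS⟩ : ∃ z ∈ insert xᶜ ((cocycle n).neighborSet x),
      z ∉ (slice (consEquiv n) S a : Set (Fin n → Bool)) := by
    refine Set.exists_mem_notMem_of_ncard_lt_ncard ?_ (Finset.finite_toSet _)
    rw [hN, Set.ncard_coe_finset]
    omega
  rw [Finset.mem_coe, mem_slice] at hzS
  have hxz : (cocycle (n + 1)).Adj (consEquiv n (a, x)) (consEquiv n (a, z)) := by
    rcases hz with rfl | hz
    · exact hclose
    · exact cocycle_adj_copy a x z hz
  have hzx : z ≠ x := by rintro rfl; exact hxz.ne rfl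
  let G' := (cocycle (n + 1)).induce ((S : Set (Fin (n + 1) → Bool))ᶜ)
  have h1 : G'.Adj ⟨consEquiv n (a, x), by simpa⟩ ⟨consEquiv n (a, z), by simpa⟩ := hxz
  have h2 : G'.Adj ⟨consEquiv n (a, z), by simpa⟩
      ⟨consEquiv n (!a, z), by simpa using hone z hzx⟩ := cocycle_adj_cross hn0 a z
  exact ⟨z, hone z hzx, h1.reachable.trans h2.reachable⟩

theorem two_mul_add_lt_two_pow (n : ℕ) : 2 * n + 4 < 2 ^ (n + 3) := by
  induction n with
  | zero => norm_num
  | succ n ih => rw [pow_succ]; omega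

theorem cocycle_isKConnected (n : ℕ) : IsKConnected (cocycle (n + 3)) (2 * n + 3) := by
  induction n with
  | zero => exact cocycle_three_isKConnected
  | succ n ih =>
    have := two_mul_add_lt_two_pow n
    exact cocycle_isKConnected_succ (by omega) (by omega) (by omega) (cocycle_isRegular (n + 1)) ih

theorem hasPath_of_numbers {n : ℕ} {G : SimpleGraph (Fin n → Bool)} (i : ℕ) (l : List ℕ)
    (h : ((i :: l).map (str n)).IsChain G.Adj ∧ ((i :: l).map (str n)).Nodup) :
    HasPath G (str n i) (str n ((i :: l).getLast (by simp))) l.length :=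
  ⟨_, h.1, h.2, by simp, by rw [List.getLast?_map, List.getLast?_eq_some_getLast (by simp)]; simp,
    by simp⟩

theorem cocycle_three_rung : Rung (cocycle 3) (str 3 1) (str 3 3) := by
  rw [Rung, card_strings]
  have h1 := hasPath_of_numbers (G := cocycle 3) 1 [3] (by decide +kernel)
  have h3 := hasPath_of_numbers (G := cocycle 3) 1 [5, 7, 3] (by decide +kernel)
  have h5 := hasPath_of_numbers (G := cocycle 3) 1 [5, 7, 4, 0, 3] (by decide +kernel)
  have h7 := hasPath_of_numbers (G := cocycle 3) 1 [5, 7, 4, 6, 2, 0, 3] (by decide +kernel)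
  have h6 := hasPath_of_numbers (G := cocycle 3) 1 [5, 2, 0, 4, 7, 3] (by decide +kernel)
  refine ⟨?_, h6⟩
  rintro k ⟨t, rfl⟩ hk
  have ht : t < 4 := by norm_num at hk; omega
  interval_cases t
  exacts [h1, h3, h5, h7]

theorem cocycle_three_isPancyclicFrom : IsPancyclicFrom (cocycle 3) 4 := by
  have hadj : (cocycle 3).Adj (str 3 3) (str 3 1) := by decide +kernel
  intro l h4 hl
  rcases Nat.even_or_odd l with hl' | ⟨t, rfl⟩
  · exact cocycle_three_rung.exists_even_isCycle hadj hl' h4 hl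
  rw [card_strings] at hl
  have ht : t = 2 ∨ t = 3 := by norm_num at hl; omega
  rcases ht with rfl | rfl
  -- The rung gives lengths 4, 6, 8 and 7, so only length 5 needs a path of its own.
  · exact (hasPath_of_numbers (G := cocycle 3) 1 [5, 2, 0, 3] (by decide +kernel)).exists_isCycle
      (by simp) hadj
  · exact cocycle_three_rung.2.exists_isCycle (by simp) hadj

/-- The rung is kept away from the two ends so that `swapEnds` will fix it. -/
theorem cocycle_pancyclic (n : ℕ) : IsPancyclicFrom (cocycle (n + 3)) 4 ∧
    ∃ c b, Rung (cocycle (n + 3)) c b ∧ (∀ x ∈ ({c, b} : Set _), num _ x ≠ 0 ∧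
      num _ x + 1 ≠ 2 ^ (n + 3)) := by
  induction n with
  | zero =>
    refine ⟨cocycle_three_isPancyclicFrom, _, _, cocycle_three_rung, ?_⟩
    rintro x (rfl | rfl) <;> decide +kernel
  | succ n ih =>
    obtain ⟨hpan, c, b, hr, hx⟩ := ih
    have hcross := cocycle_adj_cross (n := n + 3) (by omega) false
    have heven : Even (Fintype.card (Fin (n + 3) → Bool)) := by
      rw [card_strings]; exact even_two_pow (by omega)
    have h8 := eight_le_two_pow (n := n + 3) (by omega)
    refine ⟨hpan.of_matching cocycle_adj_copy heven (by rw [card_strings]; omega) (hcross c)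
      (hcross b) hr hr, _, _, Rung.of_matching cocycle_adj_copy heven (hcross c) (hcross b) hr hr, ?_⟩
    have hc := hx c (by simp)
    have := num_lt _ c
    rintro x (rfl | rfl) <;> erw [num_consEquiv] <;> rw [pow_succ _ (n + 3)] <;> simp <;> omega

/-! ### Factors preserved by doubling -/

/-- The properties of a factor of the augmented cube that are kept by the step from `n` to
`n + 1`. -/
structure IsGoodFactor {n : ℕ} (H : SimpleGraph (Fin n → Bool)) (k : ℕ) : Prop where
  isRegular : IsRegular H k
  isKConnected : IsKConnected H k
  adj_compl : ∀ x y, H.Adj x y → H.Adj xᶜ yᶜ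
  isPancyclicFrom : IsPancyclicFrom H 4
  exists_rung : ∃ c b, Rung H c b

theorem join_adj_compl {n : ℕ} {H : SimpleGraph (Fin n → Bool)} {f : (Fin n → Bool) → Fin n → Bool}
    {hf : Function.Involutive f} (hfc : ∀ x, f xᶜ = (f x)ᶜ)
    (hH : ∀ x y, H.Adj x y → H.Adj xᶜ yᶜ) (x y : Fin (n + 1) → Bool)
    (h : (join (consEquiv n) H f hf).Adj x y) : (join (consEquiv n) H f hf).Adj xᶜ yᶜ := by
  obtain ⟨⟨a, x⟩, rfl⟩ := (consEquiv n).surjective x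
  obtain ⟨⟨b, y⟩, rfl⟩ := (consEquiv n).surjective y
  rw [compl_consEquiv, compl_consEquiv, join_adj] at *
  rcases h with ⟨rfl, h⟩ | ⟨h, rfl⟩
  · exact Or.inl ⟨rfl, hH x y h⟩
  · exact Or.inr ⟨by simpa using h, hfc x⟩

theorem isGoodFactor_join {n k : ℕ} {H : SimpleGraph (Fin n → Bool)}
    {f : (Fin n → Bool) → Fin n → Bool} (hf : Function.Involutive f) (hfc : ∀ x, f xᶜ = (f x)ᶜ)
    (hn : 3 ≤ n) (hk : 1 ≤ k) (hreg : IsRegular H k) (hconn : IsKConnected H k)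
    (hcompl : ∀ x y, H.Adj x y → H.Adj xᶜ yᶜ) (hpan : IsPancyclicFrom H 4) {c b : Fin n → Bool}
    (h : Rung H c b) (h' : Rung H (f c) (f b)) :
    IsGoodFactor (join (consEquiv n) H f hf) (k + 1) := by
  have heven : Even (Fintype.card (Fin n → Bool)) := by
    rw [card_strings]; exact even_two_pow (by omega)
  have h8 := eight_le_two_pow hn
  exact ⟨join_isRegular hreg, join_isKConnected hconn hk, join_adj_compl hfc hcompl,
    hpan.of_matching join_adj_copy heven (by rw [card_strings]; omega) (join_adj_cross false c)
      (join_adj_cross false b) h h',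
    _, _, Rung.of_matching join_adj_copy heven (join_adj_cross false c) (join_adj_cross false b) h h'⟩

/-! ### The cubic factor with twisted matching -/

/-- The exchange of the all-zero and the all-one string, which follow each other in the counting
cycle. -/
def swapEnds (n : ℕ) : (Fin n → Bool) → Fin n → Bool :=
  fun x => if num n x = 0 ∨ num n x + 1 = 2 ^ n then xᶜ else x

theorem swapEnds_involutive (n : ℕ) : Function.Involutive (swapEnds n) := by
  intro x
  have := num_compl n x
  unfold swapEnds
  split_ifs with h1 h2
  · exact compl_compl x
  · omega
  · rfl

theorem swapEnds_compl {n : ℕ} (x : Fin n → Bool) : swapEnds n xᶜ = (swapEnds n x)ᶜ := by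
  have := num_compl n x
  unfold swapEnds
  split_ifs with h1 h2 h3
  · rfl
  · omega
  · omega
  · rfl

theorem swapEnds_eq_self {n : ℕ} {x : Fin n → Bool} (h : num n x ≠ 0 ∧ num n x + 1 ≠ 2 ^ n) :
    swapEnds n x = x :=
  if_neg (by omega)

theorem swapEnds_str {n i : ℕ} (h0 : i ≠ 0) (h1 : i + 1 < 2 ^ n) :
    swapEnds n (str n i) = str n i :=
  swapEnds_eq_self (by rw [num_str_of_lt (by omega)]; omega)

theorem swapEnds_last (n : ℕ) : swapEnds n (str n (2 ^ n - 1)) = str n (2 ^ n) := by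
  have hpos := Nat.two_pow_pos n
  have h := num_str_of_lt (n := n) (i := 2 ^ n - 1) (by omega)
  rw [swapEnds, if_pos (by omega), eq_comm, eq_compl_iff, num_str, h, Nat.mod_self]
  omega

theorem swapEnds_rung {n : ℕ} (hn : 3 ≤ n) :
    Rung (join (consEquiv n) (countingCycle n) (swapEnds n) (swapEnds_involutive n))
      (consEquiv n (false, str n 1)) (consEquiv n (true, str n 1)) := by
  have h8 := eight_le_two_pow hn
  have hn0 : n ≠ 0 := by omega
  have hcross {i : ℕ} (h0 : i ≠ 0) (h1 : i + 1 < 2 ^ n) :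
      (join (consEquiv n) (countingCycle n) (swapEnds n) (swapEnds_involutive n)).Adj
        (consEquiv n (false, str n i)) (consEquiv n (true, str n i)) := by
    have := join_adj_cross (e := consEquiv n) (H := countingCycle n)
      (hf := swapEnds_involutive n) false (str n i)
    rwa [swapEnds_str h0 h1] at this
  have hlast := join_adj_cross (e := consEquiv n) (H := countingCycle n)
      (hf := swapEnds_involutive n) false (str n (2 ^ n - 1))
  rw [swapEnds_last] at hlast
  rw [Rung, card_strings, pow_succ]
  constructor
  · rintro k ⟨t, rfl⟩ hk
    -- Walk t steps, cross at a vertex fixed by `swapEnds`, and walk back. Going forward from 1 the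
    -- crossing is at t + 1; for the two largest t that is an end, so the walk goes backward.
    by_cases ht : t + 2 < 2 ^ n
    · have hp := countingCycle_hasPath hn0 1 t (by omega)
      have := hp.cross join_adj_copy hp.symm (hcross (by omega) (by omega))
      convert this using 1
      omega
    · have hp := countingCycle_hasPath hn0 (2 ^ n - t + 1) t (by omega)
      have hone : str n (2 ^ n - t + 1 + t) = str n 1 := by
        rw [str_eq_iff, num_str, show 2 ^ n - t + 1 + t = 1 + 2 ^ n by omega, Nat.add_mod_right]
      rw [hone] at hp
      have := hp.symm.cross join_adj_copy hp (hcross (by omega) (by omega))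
      convert this using 1
      omega
  · have h0 := countingCycle_hasPath hn0 1 (2 ^ n - 2) (by omega)
    have h1 := countingCycle_hasPath hn0 1 (2 ^ n - 1) (by omega)
    rw [show 1 + (2 ^ n - 2) = 2 ^ n - 1 by omega] at h0
    rw [show 1 + (2 ^ n - 1) = 2 ^ n by omega] at h1
    have := h0.cross join_adj_copy h1.symm hlast
    convert this using 1
    omega

theorem swapEnds_isPancyclicFrom {n : ℕ} (hn : 3 ≤ n) :
    IsPancyclicFrom (join (consEquiv n) (countingCycle n) (swapEnds n) (swapEnds_involutive n))
      4 := by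
  have h8 := eight_le_two_pow hn
  have hn0 : n ≠ 0 := by omega
  have hcross {i : ℕ} (h0 : i ≠ 0) (h1 : i + 1 < 2 ^ n) :
      (join (consEquiv n) (countingCycle n) (swapEnds n) (swapEnds_involutive n)).Adj
        (consEquiv n (false, str n i)) (consEquiv n (true, str n i)) := by
    have := join_adj_cross (e := consEquiv n) (H := countingCycle n)
      (hf := swapEnds_involutive n) false (str n i)
    rwa [swapEnds_str h0 h1] at this
  have hlast := join_adj_cross (e := consEquiv n) (H := countingCycle n)
      (hf := swapEnds_involutive n) false (str n (2 ^ n - 1))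
  rw [swapEnds_last] at hlast
  intro l h4 hl
  rcases Nat.even_or_odd l with hl' | ⟨t, rfl⟩
  · exact (swapEnds_rung hn).exists_even_isCycle (hcross (by omega) (by omega)).symm hl' h4 hl
  rw [card_strings, pow_succ] at hl
  -- The twisted edge joins 2^n - 1 to 0 in the other copy, one step further along the cycle. The
  -- arcs back to the rung at 2^n - t thus have lengths t - 1 and t, which makes the cycle odd.
  have h0 := countingCycle_hasPath hn0 (2 ^ n - t) (t - 1) (by omega)
  have h1 := countingCycle_hasPath hn0 (2 ^ n - t) t (by omega)
  rw [show 2 ^ n - t + (t - 1) = 2 ^ n - 1 by omega] at h0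
  rw [show 2 ^ n - t + t = 2 ^ n by omega] at h1
  have := (h0.cross join_adj_copy h1.symm hlast).exists_isCycle (by omega)
    (hcross (by omega) (by omega)).symm
  convert this using 6
  omega

/-! ### Assembling the decompositions -/

theorem exists_good_decomposition_three {n : ℕ} (hn : 3 ≤ n) :
    ∃ H₁ H₂ : SimpleGraph (Fin (n + 1) → Bool), IsDecomposition (augmentedCube (n + 1)) H₁ H₂ ∧
      IsGoodFactor H₁ 3 ∧ IsGoodFactor H₂ (2 * n - 2) := by
  obtain ⟨m, rfl⟩ := Nat.exists_eq_add_of_le' hn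
  have hg : Function.Involutive fun x => (swapEnds (m + 3) x)ᶜ := fun x => by
    simp only [swapEnds_compl, compl_compl]
    exact swapEnds_involutive _ x
  refine ⟨join (consEquiv _) (countingCycle _) (swapEnds _) (swapEnds_involutive _),
    join (consEquiv _) (cocycle _) _ hg, ?_, ?_, ?_⟩
  · refine join_isDecomposition (isDecomposition_cocycle _) _ _ (by omega) (fun x => ?_)
      fun x => rfl
    unfold swapEnds
    split_ifs <;> simp
  · exact ⟨join_isRegular (countingCycle_isRegular (by omega)),
      join_isKConnected (countingCycle_isKConnected (by omega)) (by norm_num),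
      join_adj_compl swapEnds_compl fun _ _ => countingCycle_compl,
      swapEnds_isPancyclicFrom hn, _, _, swapEnds_rung hn⟩
  · obtain ⟨hpan, c, b, hr, hx⟩ := cocycle_pancyclic m
    have hr' := hr.map (f := compl) compl_injective fun x y => cocycle_compl
    have := isGoodFactor_join hg (fun x => by rw [swapEnds_compl]) hn (by omega)
      (cocycle_isRegular (m + 1)) (cocycle_isKConnected m) (fun x y => cocycle_compl) hpan hr
      (by rwa [swapEnds_eq_self (hx c (by simp)), swapEnds_eq_self (hx b (by simp))])
    convert this using 1
    omega

theorem exists_good_decomposition_succ {n k l : ℕ} (hn : 3 ≤ n) (hk : 1 ≤ k) (hl : 1 ≤ l)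
    (h : ∃ H₁ H₂ : SimpleGraph (Fin n → Bool), IsDecomposition (augmentedCube n) H₁ H₂ ∧
      IsGoodFactor H₁ k ∧ IsGoodFactor H₂ l) :
    ∃ H₁ H₂ : SimpleGraph (Fin (n + 1) → Bool), IsDecomposition (augmentedCube (n + 1)) H₁ H₂ ∧
      IsGoodFactor H₁ (k + 1) ∧ IsGoodFactor H₂ (l + 1) := by
  obtain ⟨H₁, H₂, hd, h₁, h₂⟩ := h
  obtain ⟨c₁, b₁, hr₁⟩ := h₁.exists_rung
  obtain ⟨c₂, b₂, hr₂⟩ := h₂.exists_rung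
  refine ⟨join (consEquiv n) H₁ id fun x => rfl, join (consEquiv n) H₂ compl compl_involutive,
    join_isDecomposition hd _ _ (by omega) (fun x => Or.inl rfl) fun x => rfl, ?_, ?_⟩
  · exact isGoodFactor_join _ (fun x => rfl) hn hk h₁.isRegular h₁.isKConnected h₁.adj_compl
      h₁.isPancyclicFrom hr₁ hr₁
  · exact isGoodFactor_join _ (fun x => rfl) hn hl h₂.isRegular h₂.isKConnected h₂.adj_compl
      h₂.isPancyclicFrom hr₂ (hr₂.map compl_injective h₂.adj_compl)

theorem exists_good_decomposition (d m : ℕ) :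
    ∃ H₁ H₂ : SimpleGraph (Fin (m + (4 + d)) → Bool),
      IsDecomposition (augmentedCube (m + (4 + d))) H₁ H₂ ∧
      IsGoodFactor H₁ (3 + d) ∧ IsGoodFactor H₂ (2 * m + 4 + d) := by
  induction d with
  | zero => exact exists_good_decomposition_three (n := m + 3) (by omega)
  | succ d ih =>
    exact exists_good_decomposition_succ (n := m + (4 + d)) (k := 3 + d) (l := 2 * m + 4 + d)
      (by omega) (by omega) (by omega) ih

theorem exists_decomposition_of_le {n n₁ n₂ : ℕ} (hn : 4 ≤ n) (hsum : 2 * n - 1 = n₁ + n₂)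
    (hn₁ : 2 ≤ n₁) (hle : n₁ ≤ n₂) :
    ∃ H₁ H₂ : SimpleGraph (Fin n → Bool), IsDecomposition (augmentedCube n) H₁ H₂ ∧
      (IsRegular H₁ n₁ ∧ IsKConnected H₁ n₁ ∧ (3 ≤ n₁ → IsPancyclicFrom H₁ 4)) ∧
      (IsRegular H₂ n₂ ∧ IsKConnected H₂ n₂ ∧ (3 ≤ n₂ → IsPancyclicFrom H₂ 4)) := by
  rcases hn₁.eq_or_lt with rfl | h3
  · obtain ⟨m, rfl⟩ := Nat.exists_eq_add_of_le' (show 3 ≤ n by omega)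
    obtain rfl : n₂ = 2 * m + 3 := by omega
    exact ⟨_, _, isDecomposition_cocycle _, ⟨countingCycle_isRegular (by omega),
      countingCycle_isKConnected (by omega), fun h => absurd h (by norm_num)⟩,
      cocycle_isRegular (m + 1), cocycle_isKConnected m, fun _ => (cocycle_pancyclic m).1⟩
  · obtain ⟨d, rfl⟩ := Nat.exists_eq_add_of_le (show 3 ≤ n₁ from h3)
    -- As 2n - 1 is odd, n₁ ≤ n₂ forces n₁ < n; hence d doublings starting from AQ_{m+4} reach n.
    obtain ⟨m, rfl⟩ := Nat.exists_eq_add_of_le' (show 4 + d ≤ n by omega)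
    obtain rfl : n₂ = 2 * m + 4 + d := by omega
    obtain ⟨H₁, H₂, h, h₁, h₂⟩ := exists_good_decomposition d m
    exact ⟨H₁, H₂, h, ⟨h₁.isRegular, h₁.isKConnected, fun _ => h₁.isPancyclicFrom⟩,
      h₂.isRegular, h₂.isKConnected, fun _ => h₂.isPancyclicFrom⟩

end AugCube

theorem theorem1p2 (n n₁ n₂ : ℕ) (hn : 4 ≤ n) (hsum : 2 * n - 1 = n₁ + n₂)
    (hn₁ : 2 ≤ n₁) (hn₂ : 2 ≤ n₂) :
    ∃ H₁ H₂ : SimpleGraph (Fin n → Bool),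
      AugCube.IsDecomposition (AugCube.augmentedCube n) H₁ H₂ ∧
      (AugCube.IsRegular H₁ n₁ ∧ AugCube.IsKConnected H₁ n₁ ∧
        (3 ≤ n₁ → AugCube.IsPancyclicFrom H₁ 4)) ∧
      (AugCube.IsRegular H₂ n₂ ∧ AugCube.IsKConnected H₂ n₂ ∧
        (3 ≤ n₂ → AugCube.IsPancyclicFrom H₂ 4)) := by
  rcases le_total n₁ n₂ with hle | hle
  · exact AugCube.exists_decomposition_of_le hn hsum hn₁ hle
  · obtain ⟨H₁, H₂, h, h₁, h₂⟩ :=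
      AugCube.exists_decomposition_of_le hn (hsum.trans (add_comm _ _)) hn₂ hle
    exact ⟨H₂, H₁, h.symm, h₂, h₁⟩
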